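/- Let $\mathbb N=\{0,1,2,\dots\}$ and let $p=\{p_x\}_{x\in\mathbb N}$ be a probability mass function with $p_x\ge p_{x+1}$ for all $x$. Let $X_1,X_2,\dots$ be i.i.d. $\mathbb N$-valued random variables with mass function $p$, and let $\widehat p_{n,x}=n^{-1}\#\{i\le n: X_i=x\}$ be the empirical mass function of $X_1,\dots,X_n$. For a finite real vector $w=(w_0,\dots,w_k)$, let $\mathrm{rear}(w)$ be the vector with the same entries sorted in decreasing order. Let $\mathrm{gren}(w)$ be the vector of the $k+1$ slopes, on $[x-1,x]$ for $x=0,\dots,k$, of the least concave majorant of the points $\bigl(j,\sum_{i=0}^{j}w_i\bigr)$, $j=-1,0,\dots,k$, where the empty sum is $0$. Let $\widehat p_n^R=\mathrm{rear}(\widehat p_n)$ and $\widehat p_n^G=\mathrm{gren}(\widehat p_n)$, where $\widehat p_n$ is regarded as the vector $(\widehat p_{n,0},\dots,\widehat p_{n,\max\{X_1,\dots,X_n\}})$ and the results are extended by zero to all of $\mathbb N$. Put $$Y^R_{n,x}=\sqrt n\,(\widehat p^R_{n,x}-p_x),\qquad Y^G_{n,x}=\sqrt n\,(\widehat p^G_{n,x}-p_x).$$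 Let $Y=\{Y_x\}_{x\in\mathbb N}$ be a Gaussian process with mean zero and covariance $\mathrm{Cov}(Y_x,Y_z)=p_x\delta_{x,z}-p_xp_z$ (such a process takes values in $\ell_2$ almost surely). For a sequence $q$ and $r\le s$, write $q^{(r,s)}=(q_r,\dots,q_s)$, regarded as a vector of length $s-r+1$. Suppose that $r,s\in\mathbb N$ satisfy $s-r\ge1$ and $p_{r-1}>p_r=\cdots=p_s>p_{s+1}$, where the condition $p_{r-1}>p_r$ is void if $r=0$. Then, as $n\to\infty$, in the sense of convergence in distribution of random vectors in $\mathbb R^{s-r+1}$, $$(Y_n^R)^{(r,s)}\to_d \mathrm{rear}\bigl(Y^{(r,s)}\bigr),\qquad (Y_n^G)^{(r,s)}\to_d \mathrm{gren}\bigl(Y^{(r,s)}\bigr).$$ -/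

import Mathlib

open MeasureTheory ProbabilityTheory Filter Topology

noncomputable section

/-- The entries of the vector `w`, sorted in decreasing order: `Tuple.sort w` is a permutation that
sorts `w` increasingly, and `Fin.rev` reverses the order. -/
def rear {m : ℕ} (w : Fin m → ℝ) : Fin m → ℝ :=
  fun i => w (Tuple.sort w (Fin.rev i))

/-- The points `(j, ∑_{i ≤ j} w_i)` for `j = -1, 0, …, m - 1` (with the empty sum `0` at `j = -1`).
They are parametrised by `l = j + 1 ∈ {0, …, m}`. -/
def cumulativePoints {m : ℕ} (w : Fin m → ℝ) : Set (ℝ × ℝ) :=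
  Set.range fun l : Fin (m + 1) =>
    ((l : ℝ) - 1, ∑ i with Fin.val i < Fin.val l, w i)

/-- The least concave majorant, on the set `I`, of a set `A` of points of the plane: the pointwise
infimum of all functions that are concave on `I` and lie on or above each point of `A`. -/
def leastConcaveMajorant (I : Set ℝ) (A : Set (ℝ × ℝ)) (t : ℝ) : ℝ :=
  sInf {y | ∃ g : ℝ → ℝ, ConcaveOn ℝ I g ∧ (∀ a ∈ A, a.2 ≤ g a.1) ∧ y = g t}

/-- The vector of slopes of the least concave majorant of the points `(j, ∑_{i ≤ j} w_i)`,
`j = -1, …, m - 1`; the entry at `x` is the slope on `[x - 1, x]`. -/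
def gren {m : ℕ} (w : Fin m → ℝ) : Fin m → ℝ := fun x =>
  leastConcaveMajorant (Set.Icc (-1) ((m : ℝ) - 1)) (cumulativePoints w) (x : ℝ) -
    leastConcaveMajorant (Set.Icc (-1) ((m : ℝ) - 1)) (cumulativePoints w) ((x : ℝ) - 1)

/-- The block `(q_r, …, q_s)` of a sequence `q` (for `r ≤ s`). -/
def block (r s : ℕ) (q : ℕ → ℝ) : Fin (s - r + 1) → ℝ := fun i => q (r + i)

/-- A finite vector, continued by zeros to a sequence. -/
def zeroExtend {m : ℕ} (w : Fin m → ℝ) : ℕ → ℝ :=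
  fun x => if h : x < m then w ⟨x, h⟩ else 0

variable {Ω : Type*}

/-- The empirical mass function of the first `n` observations. -/
def empiricalMass (X : ℕ → Ω → ℕ) (n : ℕ) (ω : Ω) : ℕ → ℝ :=
  fun x => (n : ℝ)⁻¹ * ∑ i ∈ Finset.range n, if X i ω = x then 1 else 0

/-- The largest of the first `n` observations. -/
def sampleMax (X : ℕ → Ω → ℕ) (n : ℕ) (ω : Ω) : ℕ :=
  (Finset.range n).sup fun i => X i ω

/-- The empirical mass function as a vector, indexed by `{0, …, sampleMax X n ω}`; it vanishes
outside this set. -/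
def empiricalVector (X : ℕ → Ω → ℕ) (n : ℕ) (ω : Ω) : Fin (sampleMax X n ω + 1) → ℝ :=
  fun x => empiricalMass X n ω x

/-- The rearrangement estimator. -/
def rearrangementEstimator (X : ℕ → Ω → ℕ) (n : ℕ) (ω : Ω) : ℕ → ℝ :=
  zeroExtend (rear (empiricalVector X n ω))

/-- The Grenander estimator (maximum likelihood estimator of a decreasing mass function). -/
def grenanderEstimator (X : ℕ → Ω → ℕ) (n : ℕ) (ω : Ω) : ℕ → ℝ :=
  zeroExtend (gren (empiricalVector X n ω))

/-- The fluctuations `√n (p̂ - p)` of an estimate `phat` of `p` from `n` observations. -/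
def fluctuation (p : PMF ℕ) (n : ℕ) (phat : ℕ → ℝ) : ℕ → ℝ :=
  fun x => √(n : ℝ) * (phat x - (p x).toReal)

/-- `Y` is a centred Gaussian process with `Cov(Y_x, Y_z) = p_x δ_{x,z} - p_x p_z`. Since
`∑ E[Y_x²] = ∑ p_x (1 - p_x) < ∞`, such a process almost surely takes values in `ℓ²`. -/
structure IsLimitProcess (p : PMF ℕ) {mΩ : MeasurableSpace Ω} (Y : ℕ → Ω → ℝ) (P : Measure Ω) :
    Prop where
  isGaussianProcess : IsGaussianProcess Y P
  mean_zero : ∀ x, ∫ ω, Y x ω ∂P = 0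
  covariance_eq : ∀ x z, cov[Y x, Y z; P] =
    (if x = z then (p x).toReal else 0) - (p x).toReal * (p z).toReal

end

/-!
Both `rear` and `gren` are continuous, commute with increasing affine maps of the entries, and act
locally: on a block whose values are at most all values before it and at least all values after it,
they depend on the block alone. For `gren` this holds because, at the grid points, the majorant is
the infimum of the affine functions above the points, and in the block the slopes of these affine
functions may be restricted to the range of the values in the block.

By the law of large numbers and since no mass escapes to infinity, the empirical mass function
almost surely ends up separating the flat stretch `{r, …, s}` from what precedes and what follows
it. From then on, by locality and affine equivariance, the fluctuation of the estimator on the block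
is `rear` or `gren` of the fluctuation of the empirical mass function on the block. The latter
converges by the multivariate central limit theorem, so the continuous mapping theorem applies.
-/

theorem nonempty_upperBounds_inter_lowerBounds {α : Type*} [LinearOrder α] [Nonempty α]
    {A B : Set α} (hA : A.Finite) (hB : B.Finite) (hAB : ∀ a ∈ A, ∀ b ∈ B, a ≤ b) :
    (upperBounds A ∩ lowerBounds B).Nonempty := by
  rcases A.eq_empty_or_nonempty with rfl | hne
  · rw [upperBounds_empty, Set.univ_inter]
    exact hB.bddBelow
  · obtain ⟨a, ha, hmax⟩ := Set.exists_max_image A id hA hne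
    exact ⟨a, hmax, hAB a ha⟩

/-- Finiteness of `s` makes this true at the endpoints of `I` as well, where a concave function
need not have a supporting line. -/
theorem exists_supporting_line_of_finite {𝕜 : Type*} [Field 𝕜] [LinearOrder 𝕜]
    [IsStrictOrderedRing 𝕜] {I s : Set 𝕜} {g : 𝕜 → 𝕜} (hg : ConcaveOn 𝕜 I g) (hs : s.Finite)
    (hsI : s ⊆ I) {u : 𝕜} (hu : u ∈ I) : ∃ c, ∀ t ∈ s, g t ≤ g u + c * (t - u) := by
  obtain ⟨c, hright, hleft⟩ := nonempty_upperBounds_inter_lowerBounds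
    ((hs.subset (Set.sep_subset s (u < ·))).image fun t => (g t - g u) / (t - u))
    ((hs.subset (Set.sep_subset s (· < u))).image fun t => (g u - g t) / (u - t)) <| by
      rintro _ ⟨y, ⟨hy, huy⟩, rfl⟩ _ ⟨x, ⟨hx, hxu⟩, rfl⟩
      exact hg.slope_anti_adjacent (hsI hx) (hsI hy) hxu huy
  refine ⟨c, fun t ht => ?_⟩
  rcases lt_trichotomy t u with htu | rfl | hut
  · have hslope := hleft ⟨t, ⟨ht, htu⟩, rfl⟩
    rw [le_div_iff₀ (sub_pos.2 htu)] at hslope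
    linarith
  · simp
  · have hslope := hright ⟨t, ⟨ht, hut⟩, rfl⟩
    rw [div_le_iff₀ (sub_pos.2 hut)] at hslope
    linarith

/-- The values of `q` on `{r, …, s}` separate its earlier values from its later ones: this is the
condition under which monotone regression of `q` acts on the block `{r, …, s}` alone. -/
structure IsSeparatedBlock (q : ℕ → ℝ) (r s : ℕ) : Prop where
  le_left : ∀ x < r, ∀ y ∈ Set.Icc r s, q y ≤ q x
  right_le : ∀ y ∈ Set.Icc r s, ∀ x > s, q x ≤ q y

theorem IsSeparatedBlock.exists_levels {q : ℕ → ℝ} {r s : ℕ} (h : IsSeparatedBlock q r s)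
    (hrs : r ≤ s) :
    ∃ c₁ c₂, c₁ ≤ c₂ ∧ (∀ x < r, c₂ ≤ q x) ∧ (∀ y ∈ Set.Icc r s, q y ∈ Set.Icc c₁ c₂) ∧
      ∀ x > s, q x ≤ c₁ := by
  have hne : (Set.Icc r s).Nonempty := Set.nonempty_Icc.2 hrs
  obtain ⟨a, ha, hmin⟩ := Set.exists_min_image _ q (Set.finite_Icc r s) hne
  obtain ⟨b, hb, hmax⟩ := Set.exists_max_image _ q (Set.finite_Icc r s) hne
  exact ⟨q a, q b, hmin b hb, fun x hx => h.le_left x hx b hb,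
    fun y hy => ⟨hmin y hy, hmax y hy⟩, h.right_le a ha⟩

theorem block_zeroExtend_apply {m r s : ℕ} (w : Fin m → ℝ) (hrs : r ≤ s) (hsm : s < m)
    (i : Fin (s - r + 1)) : block r s (zeroExtend w) i = w ⟨r + i, by omega⟩ :=
  dif_pos _

section Rearrangement

variable {m : ℕ}

theorem antitone_rear (w : Fin m → ℝ) : Antitone (rear w) :=
  fun _ _ hij => Tuple.monotone_sort w (Fin.rev_le_rev.2 hij)

theorem card_le_rear (w : Fin m → ℝ) (a : ℝ) :
    Finset.card {j | a ≤ rear w j} = Finset.card {j | a ≤ w j} :=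
  Finset.card_equiv (Fin.revPerm.trans (Tuple.sort w)) fun j => by
    simp only [Finset.mem_filter_univ]
    rfl

theorem le_rear_iff (w : Fin m → ℝ) (i : Fin m) (a : ℝ) :
    a ≤ rear w i ↔ i < Finset.card {j | a ≤ w j} := by
  rw [← card_le_rear, Tuple.lt_card_ge_iff_apply_ge_of_antitone (antitone_rear w)]

theorem rear_mono {v w : Fin m → ℝ} (h : v ≤ w) : rear v ≤ rear w := fun i =>
  le_of_forall_le fun a hav => by
    rw [le_rear_iff] at hav ⊢
    exact hav.trans_le (Finset.card_le_card
      (Finset.monotone_filter_right _ fun j _ hj => hj.trans (h j)))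

theorem rear_mul_add (w : Fin m → ℝ) {a : ℝ} (ha : 0 < a) (c : ℝ) (i : Fin m) :
    rear (fun j => a * w j + c) i = a * rear w i + c := by
  refine eq_of_forall_le_iff fun b => ?_
  have le_affine_iff (x : ℝ) : b ≤ a * x + c ↔ (b - c) / a ≤ x := by
    rw [div_le_iff₀' ha, sub_le_iff_le_add]
  simp only [le_affine_iff, le_rear_iff]

theorem continuous_rear : Continuous (rear : (Fin m → ℝ) → Fin m → ℝ) := by
  refine continuous_pi fun i => (LipschitzWith.of_le_add fun v w => ?_).continuous
  have hle : v ≤ fun j => 1 * w j + dist v w := fun j => by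
    have := (le_abs_self _).trans (dist_le_pi_dist v w j)
    linarith
  calc rear v i ≤ rear (fun j => 1 * w j + dist v w) i := rear_mono hle i
    _ = rear w i + dist v w := by rw [rear_mul_add w one_pos, one_mul]

theorem card_filter_fin_val (P : ℕ → Prop) [DecidablePred P] :
    Finset.card {j : Fin m | P j} = Nat.count P m := by
  rw [Nat.count_eq_card_filter_range, Finset.card_filter, Finset.card_filter,
    Fin.sum_univ_eq_sum_range (fun x => if P x then 1 else 0)]

theorem block_zeroExtend_rear {q : ℕ → ℝ} {r s : ℕ} (hq : IsSeparatedBlock q r s)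
    (hrs : r ≤ s) (hsm : s < m) :
    block r s (zeroExtend (rear fun x : Fin m => q x)) = rear (block r s q) := by
  ext i
  rw [block_zeroExtend_apply _ hrs hsm]
  refine eq_of_forall_le_iff fun a => ?_
  obtain ⟨d, rfl⟩ : ∃ d, m = r + (s - r + 1) + d := ⟨m - (s + 1), by omega⟩
  have hbefore : Nat.count (a ≤ q ·) r = r ∨
      Nat.count (fun x => a ≤ q (r + x)) (s - r + 1) = 0 := by
    simp only [Nat.count_iff_forall, Nat.count_iff_forall_not]
    by_contra! h
    obtain ⟨⟨x, hx, hxa⟩, y, hy, hya⟩ := h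
    exact hxa.not_ge (hya.trans (hq.le_left x hx (r + y) ⟨by omega, by omega⟩))
  have hafter : Nat.count (fun x => a ≤ q (r + x)) (s - r + 1) = s - r + 1 ∨
      Nat.count (fun x => a ≤ q (r + (s - r + 1) + x)) d = 0 := by
    simp only [Nat.count_iff_forall, Nat.count_iff_forall_not]
    by_contra! h
    obtain ⟨⟨y, hy, hya⟩, x, _, hxa⟩ := h
    exact hya.not_ge (hxa.trans (hq.right_le (r + y) ⟨by omega, by omega⟩ _ (by omega)))
  have hbefore_le : Nat.count (a ≤ q ·) r ≤ r := Nat.count_le _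
  have hcard : Finset.card {j | a ≤ block r s q j} =
      Nat.count (fun x => a ≤ q (r + x)) (s - r + 1) :=
    card_filter_fin_val fun x => a ≤ q (r + x)
  rw [le_rear_iff, le_rear_iff, hcard, card_filter_fin_val (a ≤ q ·),
    Nat.count_add _ (r + (s - r + 1)), Nat.count_add _ r]
  dsimp only
  omega

end Rearrangement

section Grenander

theorem concaveOn_const_add_mul_sub {s : Set ℝ} (hs : Convex ℝ s) (y c u : ℝ) :
    ConcaveOn ℝ s fun t => y + c * (t - u) :=
  ((((LinearMap.mulLeft ℝ c).concaveOn hs).add_const (y - c * u)).congr fun t _ => by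
    simp only [LinearMap.mulLeft_apply, Pi.add_apply]
    ring)

variable {m : ℕ}

/-- The sum of the first `l` entries of `w`, which is the ordinate of the cumulative point with
abscissa `l - 1`. -/
def partialSum (w : Fin m → ℝ) (l : ℕ) : ℝ :=
  ∑ i with Fin.val i < l, w i

/-- The values at `u` of the affine functions that lie on or above the sequence `S` on `I`. -/
def affineMajorantValues (S : ℕ → ℝ) (I : Set ℕ) (u : ℕ) : Set ℝ :=
  {y | ∃ c : ℝ, ∀ l ∈ I, S l ≤ y + c * ((l : ℝ) - u)}

/-- The value of the least concave majorant in the definition of `gren w`, indexed by the number `u`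
of summands: its abscissa is `u - 1`. -/
noncomputable def grenMajorant (w : Fin m → ℝ) (u : ℕ) : ℝ :=
  leastConcaveMajorant (Set.Icc (-1) ((m : ℝ) - 1)) (cumulativePoints w) ((u : ℝ) - 1)

theorem gren_apply (w : Fin m → ℝ) (x : Fin m) :
    gren w x = grenMajorant w (x + 1) - grenMajorant w x := by
  simp only [gren, grenMajorant, Nat.cast_add, Nat.cast_one, add_sub_cancel_right]

theorem grenMajorant_eq_sInf (w : Fin m → ℝ) {u : ℕ} (hu : u ≤ m) :
    grenMajorant w u = sInf (affineMajorantValues (partialSum w) (Set.Iic m) u) := by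
  have cast_sub_one_mem {l : ℕ} (hl : l ≤ m) : (l : ℝ) - 1 ∈ Set.Icc (-1) ((m : ℝ) - 1) :=
    ⟨by simp, by simpa using hl⟩
  refine congrArg sInf (Set.ext fun y => ⟨?_, fun ⟨c, hc⟩ => ?_⟩)
  · rintro ⟨g, hg, hmaj, rfl⟩
    obtain ⟨c, hc⟩ := exists_supporting_line_of_finite hg
      ((Set.finite_Iic m).image fun l : ℕ => (l : ℝ) - 1)
      (Set.image_subset_iff.2 fun l hl => cast_sub_one_mem hl) (cast_sub_one_mem hu)
    refine ⟨c, fun l hl => ?_⟩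
    calc partialSum w l ≤ g (l - 1) := hmaj _ ⟨⟨l, Nat.lt_succ_of_le hl⟩, rfl⟩
      _ ≤ g (u - 1) + c * ((l - 1) - (u - 1)) := hc _ ⟨l, hl, rfl⟩
      _ = g (u - 1) + c * (l - u) := by rw [sub_sub_sub_cancel_right]
  · refine ⟨_, concaveOn_const_add_mul_sub (convex_Icc _ _) y c (u - 1), ?_, by simp⟩
    rintro _ ⟨l, rfl⟩
    calc partialSum w l ≤ y + c * (l - u) := hc l (Nat.le_of_lt_succ l.2)
      _ = y + c * ((l - 1) - (u - 1)) := by rw [sub_sub_sub_cancel_right]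

theorem isGLB_grenMajorant (w : Fin m → ℝ) {u : ℕ} (hu : u ≤ m) :
    IsGLB (affineMajorantValues (partialSum w) (Set.Iic m) u) (grenMajorant w u) := by
  rw [grenMajorant_eq_sInf w hu]
  refine isGLB_csInf ?_ ⟨partialSum w u, fun y ⟨c, hc⟩ => by simpa using hc u hu⟩
  obtain ⟨b, hb⟩ := ((Set.finite_Iic m).image (partialSum w)).bddAbove
  exact ⟨b, 0, fun l hl => by simpa using hb ⟨l, hl, rfl⟩⟩

theorem grenMajorant_le_of_partialSum_le {v w : Fin m → ℝ} {a c ε : ℝ} (ha : 0 < a)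
    (h : ∀ l ≤ m, partialSum v l ≤ a * partialSum w l + c * l + ε) {u : ℕ} (hu : u ≤ m) :
    grenMajorant v u ≤ a * grenMajorant w u + c * u + ε := by
  suffices (grenMajorant v u - c * u - ε) / a ≤ grenMajorant w u by
    rw [div_le_iff₀' ha] at this
    linarith
  refine (isGLB_grenMajorant w hu).2 fun y ⟨b, hb⟩ => ?_
  suffices grenMajorant v u ≤ a * y + c * u + ε by
    rw [div_le_iff₀' ha]
    linarith
  refine (isGLB_grenMajorant v hu).1 ⟨a * b + c, fun l hl => ?_⟩
  calc partialSum v l ≤ a * partialSum w l + c * l + ε := h l hl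
    _ ≤ a * (y + b * (l - u)) + c * l + ε := by gcongr; exact hb l hl
    _ = a * y + c * u + ε + (a * b + c) * (l - u) := by ring

theorem partialSum_mul_add (w : Fin m → ℝ) (a c : ℝ) {l : ℕ} (hl : l ≤ m) :
    partialSum (fun j => a * w j + c) l = a * partialSum w l + c * l := by
  rw [partialSum, Finset.sum_add_distrib, ← Finset.mul_sum, Finset.sum_const,
    Fin.card_filter_val_lt, min_eq_right hl, nsmul_eq_mul, mul_comm c]
  rfl

theorem grenMajorant_mul_add (w : Fin m → ℝ) {a : ℝ} (ha : 0 < a) (c : ℝ) {u : ℕ} (hu : u ≤ m) :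
    grenMajorant (fun j => a * w j + c) u = a * grenMajorant w u + c * u := by
  refine le_antisymm ?_ ?_
  · simpa only [add_zero] using grenMajorant_le_of_partialSum_le (ε := 0) ha
      (fun l hl => by rw [partialSum_mul_add w a c hl, add_zero]) hu
  · have hinv := grenMajorant_le_of_partialSum_le (v := w) (w := fun j => a * w j + c)
      (c := -(a⁻¹ * c)) (ε := 0) (inv_pos.2 ha)
      (fun l hl => by rw [partialSum_mul_add w a c hl]; field_simp; simp) hu
    have hscale := mul_le_mul_of_nonneg_left hinv ha.le
    field_simp at hscale
    linarith

theorem gren_mul_add (w : Fin m → ℝ) {a : ℝ} (ha : 0 < a) (c : ℝ) (i : Fin m) :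
    gren (fun j => a * w j + c) i = a * gren w i + c := by
  rw [gren_apply, gren_apply, grenMajorant_mul_add w ha c i.2, grenMajorant_mul_add w ha c i.2.le]
  push_cast
  ring

theorem partialSum_le_add_dist (v w : Fin m → ℝ) (l : ℕ) :
    partialSum v l ≤ partialSum w l + m * dist v w := by
  rw [← sub_le_iff_le_add', partialSum, partialSum, ← Finset.sum_sub_distrib]
  calc ∑ i with Fin.val i < l, (v i - w i) ≤ ∑ i : Fin m with i.val < l, dist v w :=
        Finset.sum_le_sum fun i _ => (le_abs_self _).trans (dist_le_pi_dist v w i)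
    _ ≤ ∑ _i : Fin m, dist v w :=
        Finset.sum_le_univ_sum_of_nonneg fun _ => dist_nonneg
    _ = m * dist v w := by simp

theorem continuous_grenMajorant {u : ℕ} (hu : u ≤ m) :
    Continuous fun w : Fin m → ℝ => grenMajorant w u := by
  refine (LipschitzWith.of_le_add_mul m fun v w => ?_).continuous
  simpa using grenMajorant_le_of_partialSum_le (a := 1) (c := 0) one_pos
    (fun l _ => by simpa using partialSum_le_add_dist v w l) hu

theorem continuous_gren : Continuous (gren : (Fin m → ℝ) → Fin m → ℝ) := by
  refine continuous_pi fun i => ?_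
  simp only [gren_apply]
  exact (continuous_grenMajorant i.2).sub (continuous_grenMajorant i.2.le)

theorem sum_range_le_add_mul {q : ℕ → ℝ} {a b : ℕ} {c : ℝ} (hab : a ≤ b)
    (h : ∀ x, a ≤ x → x < b → q x ≤ c) :
    ∑ x ∈ Finset.range b, q x ≤ ∑ x ∈ Finset.range a, q x + c * ((b : ℝ) - a) := by
  rw [← sub_le_iff_le_add', ← Finset.sum_Ico_eq_sub _ hab]
  calc ∑ x ∈ Finset.Ico a b, q x ≤ (Finset.Ico a b).card • c :=
        Finset.sum_le_card_nsmul _ _ _ fun x hx =>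
          h x (Finset.mem_Ico.1 hx).1 (Finset.mem_Ico.1 hx).2
    _ = c * ((b : ℝ) - a) := by rw [Nat.card_Ico, nsmul_eq_mul, Nat.cast_sub hab, mul_comm]

theorem add_mul_le_sum_range {q : ℕ → ℝ} {a b : ℕ} {c : ℝ} (hab : a ≤ b)
    (h : ∀ x, a ≤ x → x < b → c ≤ q x) :
    ∑ x ∈ Finset.range a, q x + c * ((b : ℝ) - a) ≤ ∑ x ∈ Finset.range b, q x := by
  have hneg := sum_range_le_add_mul (q := -q) hab fun x ha hb => neg_le_neg (h x ha hb)
  simp only [Pi.neg_apply, Finset.sum_neg_distrib] at hneg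
  linarith

theorem exists_slope_mem_Icc {S : ℕ → ℝ} {a b u : ℕ} {c₁ c₂ y : ℝ} (hu : u ∈ Set.Icc a b)
    (hc : c₁ ≤ c₂) (hlower : ∀ l ∈ Set.Icc a b, S l + c₁ * ((b : ℝ) - l) ≤ S b)
    (hupper : ∀ l ∈ Set.Icc a b, S l ≤ S a + c₂ * ((l : ℝ) - a))
    (hy : y ∈ affineMajorantValues S (Set.Icc a b) u) :
    ∃ c ∈ Set.Icc c₁ c₂, ∀ l ∈ Set.Icc a b, S l ≤ y + c * ((l : ℝ) - u) := by
  obtain ⟨c, hmaj⟩ := hy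
  have hab : a ≤ b := hu.1.trans hu.2
  have hau : (a : ℝ) ≤ u := by exact_mod_cast hu.1
  have hub : (u : ℝ) ≤ b := by exact_mod_cast hu.2
  rcases lt_or_ge c c₁ with hcc | hcc
  · refine ⟨c₁, Set.left_mem_Icc.2 hc, fun l hl => ?_⟩
    have hsteeper := mul_le_mul_of_nonneg_right hcc.le (sub_nonneg.2 hub)
    linarith [hlower l hl, hmaj b (Set.right_mem_Icc.2 hab)]
  rcases lt_or_ge c₂ c with hcc' | hcc'
  · refine ⟨c₂, Set.right_mem_Icc.2 hc, fun l hl => ?_⟩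
    have hflatter := mul_le_mul_of_nonneg_right hcc'.le (sub_nonneg.2 hau)
    linarith [hupper l hl, hmaj a (Set.left_mem_Icc.2 hab)]
  · exact ⟨c, ⟨hcc, hcc'⟩, hmaj⟩

theorem IsSeparatedBlock.affineMajorantValues_eq {q : ℕ → ℝ} {r s m u : ℕ}
    (hq : IsSeparatedBlock q r s) (hrs : r ≤ s) (hsm : s < m) (hu : u ∈ Set.Icc r (s + 1)) :
    affineMajorantValues (fun l => ∑ x ∈ Finset.range l, q x) (Set.Iic m) u =
      affineMajorantValues (fun l => ∑ x ∈ Finset.range l, q x) (Set.Icc r (s + 1)) u := by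
  obtain ⟨c₁, c₂, hc, hleft, hblock, hright⟩ := hq.exists_levels hrs
  refine Set.Subset.antisymm
    (fun y ⟨c, hmaj⟩ => ⟨c, fun l hl => hmaj l (hl.2.trans hsm)⟩) fun y hy => ?_
  obtain ⟨c, ⟨hc₁, hc₂⟩, hmaj⟩ := exists_slope_mem_Icc hu hc
    (fun l hl => add_mul_le_sum_range hl.2 fun x hlx hxs =>
      (hblock x ⟨hl.1.trans hlx, Nat.le_of_lt_succ hxs⟩).1)
    (fun l hl => sum_range_le_add_mul hl.1 fun x hrx hxl =>
      (hblock x ⟨hrx, Nat.le_of_lt_succ (hxl.trans_le hl.2)⟩).2) hy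
  have hmaj_r := hmaj r ⟨le_rfl, by omega⟩
  have hmaj_s := hmaj (s + 1) ⟨by omega, le_rfl⟩
  refine ⟨c, fun l _ => ?_⟩
  rcases le_total l r with hlr | hrl
  · have hincr := add_mul_le_sum_range hlr fun x _ hxr => hleft x hxr
    have hlr' : (l : ℝ) ≤ r := by exact_mod_cast hlr
    have hslope := mul_le_mul_of_nonneg_right hc₂ (sub_nonneg.2 hlr')
    linarith
  rcases le_total l (s + 1) with hls | hsl
  · exact hmaj l ⟨hrl, hls⟩
  · have hincr := sum_range_le_add_mul hsl fun x hsx _ => hright x hsx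
    have hsl' : ((s + 1 : ℕ) : ℝ) ≤ l := by exact_mod_cast hsl
    have hslope := mul_le_mul_of_nonneg_right hc₁ (sub_nonneg.2 hsl')
    linarith

theorem affineMajorantValues_Icc_add {S T : ℕ → ℝ} {r k : ℕ} {b : ℝ}
    (hST : ∀ l ≤ k, S (r + l) = b + T l) (u : ℕ) :
    affineMajorantValues S (Set.Icc r (r + k)) (r + u) =
      OrderIso.addLeft b '' affineMajorantValues T (Set.Iic k) u := by
  ext y
  rw [OrderIso.image_eq_preimage_symm]
  refine exists_congr fun c => ⟨fun hmaj l hl => ?_, fun hmaj l hl => ?_⟩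
  · have hmaj_l := hmaj (r + l) ⟨by omega, Nat.add_le_add_left hl r⟩
    rw [hST l hl] at hmaj_l
    push_cast at hmaj_l
    simp only [OrderIso.addLeft_symm, OrderIso.addLeft_apply]
    linarith
  · obtain ⟨l, rfl⟩ := Nat.exists_eq_add_of_le hl.1
    have hlk : l ≤ k := Nat.le_of_add_le_add_left hl.2
    have hmaj_l := hmaj l hlk
    simp only [OrderIso.addLeft_symm, OrderIso.addLeft_apply] at hmaj_l
    rw [hST l hlk]
    push_cast
    linarith

theorem partialSum_fin_val (q : ℕ → ℝ) {l : ℕ} (hl : l ≤ m) :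
    partialSum (fun x : Fin m => q x) l = ∑ x ∈ Finset.range l, q x := by
  rw [partialSum, Finset.sum_filter, Fin.sum_univ_eq_sum_range (fun x => if x < l then q x else 0),
    ← Finset.sum_filter, Finset.range_eq_Ico, Finset.range_eq_Ico, Finset.Ico_filter_lt,
    min_eq_right hl]

theorem affineMajorantValues_congr {S T : ℕ → ℝ} {I : Set ℕ} (hST : ∀ l ∈ I, S l = T l) (u : ℕ) :
    affineMajorantValues S I u = affineMajorantValues T I u :=
  Set.ext fun _ => exists_congr fun _ => forall₂_congr fun l hl => by rw [hST l hl]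

theorem grenMajorant_add_eq {q : ℕ → ℝ} {r s u : ℕ} (hq : IsSeparatedBlock q r s)
    (hrs : r ≤ s) (hsm : s < m) (hu : u ≤ s - r + 1) :
    grenMajorant (fun x : Fin m => q x) (r + u) =
      ∑ x ∈ Finset.range r, q x + grenMajorant (block r s q) u := by
  have hglb := isGLB_grenMajorant (fun x : Fin m => q x) (u := r + u) (by omega)
  have hsplit : ∀ l ≤ s - r + 1, ∑ x ∈ Finset.range (r + l), q x =
      ∑ x ∈ Finset.range r, q x + partialSum (block r s q) l := fun l hl => by
    rw [Finset.sum_range_add]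
    exact congrArg _ (partialSum_fin_val (fun x => q (r + x)) hl).symm
  rw [affineMajorantValues_congr (I := Set.Iic m) (fun l hl => partialSum_fin_val q hl),
    hq.affineMajorantValues_eq hrs hsm ⟨by omega, by omega⟩,
    show s + 1 = r + (s - r + 1) by omega, affineMajorantValues_Icc_add hsplit u] at hglb
  exact hglb.unique ((OrderIso.addLeft _).isGLB_image'.2 (isGLB_grenMajorant _ hu))

theorem block_zeroExtend_gren {q : ℕ → ℝ} {r s : ℕ} (hq : IsSeparatedBlock q r s)
    (hrs : r ≤ s) (hsm : s < m) :
    block r s (zeroExtend (gren fun x : Fin m => q x)) = gren (block r s q) := by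
  ext i
  rw [block_zeroExtend_apply _ hrs hsm, gren_apply, gren_apply, add_assoc r,
    grenMajorant_add_eq hq hrs hsm i.2, grenMajorant_add_eq hq hrs hsm i.2.le]
  ring

end Grenander

/-- A family of functionals of finite vectors, one for each length, which are continuous, commute
with increasing affine transformations of the entries, and act on a separated block of a sequence
as if the rest of the sequence were absent. -/
structure IsBlockwiseEquivariant (Ψ : ∀ m, (Fin m → ℝ) → Fin m → ℝ) : Prop where
  continuous : ∀ m, Continuous (Ψ m)
  map_mul_add : ∀ {m} (w : Fin m → ℝ) {a : ℝ}, 0 < a → ∀ c i,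
    Ψ m (fun j => a * w j + c) i = a * Ψ m w i + c
  block_zeroExtend : ∀ {q r s m}, IsSeparatedBlock q r s → r ≤ s → s < m →
    block r s (zeroExtend (Ψ m fun x => q x)) = Ψ (s - r + 1) (block r s q)

theorem isBlockwiseEquivariant_rear : IsBlockwiseEquivariant fun _ => rear where
  continuous _ := continuous_rear
  map_mul_add w _ := rear_mul_add w
  block_zeroExtend := block_zeroExtend_rear

theorem isBlockwiseEquivariant_gren : IsBlockwiseEquivariant fun _ => gren where
  continuous _ := continuous_gren
  map_mul_add w _ := gren_mul_add w
  block_zeroExtend := block_zeroExtend_gren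

section Separation

variable {α ι : Type*} {l : Filter ι} {q : ι → α → ℝ} {f : α → ℝ} {A : ℝ}

theorem exists_finset_eventually_forall_notMem_lt (hf : HasSum f A)
    (hq : ∀ n (F : Finset α), ∑ x ∈ F, q n x ≤ A)
    (hlim : ∀ x, Tendsto (fun n => q n x) l (𝓝 (f x))) {ε : ℝ} (hε : 0 < ε) :
    ∃ F : Finset α, ∀ᶠ n in l, ∀ x ∉ F, q n x < ε := by
  classical
  obtain ⟨F, hF⟩ := (hf.eventually_const_lt (sub_lt_self A hε)).exists
  refine ⟨F, ?_⟩
  filter_upwards [(tendsto_finsetSum F fun x _ => hlim x).eventually_const_lt hF] with n hn x hx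
  have htotal := hq n (insert x F)
  rw [Finset.sum_insert hx] at htotal
  linarith

theorem eventually_forall_lt_of_tendsto (hf : HasSum f A)
    (hq : ∀ n (F : Finset α), ∑ x ∈ F, q n x ≤ A)
    (hlim : ∀ x, Tendsto (fun n => q n x) l (𝓝 (f x))) {y : α} (hy : 0 < f y) {K : Set α}
    (hK : ∀ x ∈ K, f x < f y) : ∀ᶠ n in l, ∀ x ∈ K, q n x < q n y := by
  obtain ⟨c, hc, hcy⟩ := exists_between hy
  obtain ⟨F, hF⟩ := exists_finset_eventually_forall_notMem_lt hf hq hlim hc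
  have hlt : ∀ᶠ n in l, ∀ x ∈ F, x ∈ K → q n x < q n y :=
    (eventually_all_finset F).2 fun x _ => eventually_imp_distrib_left.2 fun hx =>
      (hlim x).eventually_lt (hlim y) (hK x hx)
  filter_upwards [hF, hlt, (hlim y).eventually_const_lt hcy] with n hsmall hlt hlarge x hx
  by_cases hxF : x ∈ F
  · exact hlt x hxF hx
  · exact (hsmall x hxF).trans hlarge

theorem eventually_isSeparatedBlock {q : ι → ℕ → ℝ} {f : ℕ → ℝ} {r s : ℕ} (hf : HasSum f A)
    (hq : ∀ n (F : Finset ℕ), ∑ x ∈ F, q n x ≤ A)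
    (hlim : ∀ x, Tendsto (fun n => q n x) l (𝓝 (f x))) (hpos : ∀ y ∈ Set.Icc r s, 0 < f y)
    (hleft : ∀ x < r, ∀ y ∈ Set.Icc r s, f y < f x)
    (hright : ∀ y ∈ Set.Icc r s, ∀ x > s, f x < f y) :
    ∀ᶠ n in l, IsSeparatedBlock (q n) r s := by
  have hbefore : ∀ᶠ n in l, ∀ x ∈ Set.Iio r, ∀ y ∈ Set.Icc r s, q n y ≤ q n x :=
    (eventually_all_finite (Set.finite_Iio r)).2 fun x hx =>
      (eventually_all_finite (Set.finite_Icc r s)).2 fun y hy =>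
        ((hlim y).eventually_lt (hlim x) (hleft x hx y hy)).mono fun _ => le_of_lt
  have hafter : ∀ᶠ n in l, ∀ y ∈ Set.Icc r s, ∀ x ∈ Set.Ioi s, q n x < q n y :=
    (eventually_all_finite (Set.finite_Icc r s)).2 fun y hy =>
      eventually_forall_lt_of_tendsto hf hq hlim (hpos y hy) (hright y hy)
  filter_upwards [hbefore, hafter] with n hbefore hafter
  exact ⟨hbefore, fun y hy x hx => (hafter y hy x hx).le⟩

end Separation

section CentralLimit

variable {Ω Ω' ι : Type*} [MeasurableSpace Ω] [MeasurableSpace Ω'] {P : Measure Ω}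
  {P' : Measure Ω'}

theorem charFun_map_eq_charFun_map_inner {E : Type*} [NormedAddCommGroup E]
    [InnerProductSpace ℝ E] [SecondCountableTopology E] [MeasurableSpace E] [BorelSpace E]
    {V : Ω → E} (hV : AEMeasurable V P) (t : E) :
    charFun (P.map V) t = charFun (P.map fun ω => inner ℝ (V ω) t) 1 := by
  rw [charFun_apply, charFun_apply, integral_map hV (by fun_prop),
    integral_map (by fun_prop) (by fun_prop)]
  simp

theorem integral_sum_mul [Fintype ι] {V : Ω → ι → ℝ} (hV : ∀ i, Integrable (fun ω => V ω i) P)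
    (t : ι → ℝ) : ∫ ω, ∑ i, t i * V ω i ∂P = ∑ i, t i * ∫ ω, V ω i ∂P := by
  rw [integral_finsetSum _ fun i _ => (hV i).const_mul (t i)]
  simp_rw [integral_const_mul]

theorem variance_sum_mul [Fintype ι] [IsFiniteMeasure P] {V : Ω → ι → ℝ}
    (hV : ∀ i, MemLp (fun ω => V ω i) 2 P) (t : ι → ℝ) :
    Var[fun ω => ∑ i, t i * V ω i; P] =
      ∑ i, ∑ j, t i * (t j * cov[fun ω => V ω i, fun ω => V ω j; P]) := by
  rw [variance_fun_sum fun i => (hV i).const_mul (t i)]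
  simp_rw [covariance_const_mul_left, covariance_const_mul_right]

theorem hasLaw_sum_mul_of_hasGaussianLaw [Fintype ι] {W : Ω' → ι → ℝ}
    (hW : HasGaussianLaw W P') (hmean : ∀ i, ∫ ω, W ω i ∂P' = 0) (t : ι → ℝ) :
    HasLaw (fun ω => ∑ i, t i * W ω i)
      (gaussianReal 0 Var[fun ω => ∑ i, t i * W ω i; P'].toNNReal) P' := by
  have hgauss : HasGaussianLaw (fun ω => ∑ i, t i * W ω i) P' := by
    simpa using hW.map_fun (∑ i, t i • ContinuousLinearMap.proj (R := ℝ) (φ := fun _ => ℝ) i)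
  have hmean_sum : ∫ ω, ∑ i, t i * W ω i ∂P' = 0 := by
    simp [integral_sum_mul (fun i => (hW.eval i).integrable) t, hmean]
  exact ⟨hgauss.aemeasurable, by rw [hgauss.map_eq_gaussianReal, hmean_sum]⟩

variable [IsProbabilityMeasure P] [IsProbabilityMeasure P']

theorem tendstoInDistribution_of_forall_inner {E : Type*} [NormedAddCommGroup E]
    [InnerProductSpace ℝ E] [FiniteDimensional ℝ E] [MeasurableSpace E] [BorelSpace E]
    {Z : ℕ → Ω → E} {W : Ω' → E} (hZ : ∀ n, AEMeasurable (Z n) P) (hW : AEMeasurable W P')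
    (h : ∀ t : E, TendstoInDistribution (fun n ω => inner ℝ (Z n ω) t) atTop
      (fun ω => inner ℝ (W ω) t) (fun _ => P) P') :
    TendstoInDistribution Z atTop W (fun _ => P) P' := by
  refine ⟨hZ, hW, ProbabilityMeasure.tendsto_iff_tendsto_charFun.2 fun t => ?_⟩
  have hinner := ProbabilityMeasure.tendsto_iff_tendsto_charFun.1 (h t).tendsto 1
  simp only [ProbabilityMeasure.coe_mk] at hinner ⊢
  rw [charFun_map_eq_charFun_map_inner hW]
  exact hinner.congr fun n => (charFun_map_eq_charFun_map_inner (hZ n) t).symm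

theorem tendstoInDistribution_pi_of_forall_sum_mul [Fintype ι] {Z : ℕ → Ω → ι → ℝ} {W : Ω' → ι → ℝ}
    (hZ : ∀ n, AEMeasurable (Z n) P) (hW : AEMeasurable W P')
    (h : ∀ t : ι → ℝ, TendstoInDistribution (fun n ω => ∑ i, t i * Z n ω i) atTop
      (fun ω => ∑ i, t i * W ω i) (fun _ => P) P') :
    TendstoInDistribution Z atTop W (fun _ => P) P' := by
  have hL2 : TendstoInDistribution (fun n ω => WithLp.toLp 2 (Z n ω)) atTop
      (fun ω => WithLp.toLp 2 (W ω)) (fun _ => P) P' := by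
    refine tendstoInDistribution_of_forall_inner (E := EuclideanSpace ℝ ι)
      (fun n => by fun_prop) (by fun_prop) fun t => ?_
    simpa only [PiLp.inner_apply, RCLike.inner_apply, conj_trivial] using h t
  exact hL2.continuous_comp (g := fun x => WithLp.ofLp x) (PiLp.continuous_ofLp 2 _)

theorem tendstoInDistribution_pi_inv_sqrt_mul_sum_sub [Finite ι] {ξ : ℕ → Ω → ι → ℝ}
    {W : Ω' → ι → ℝ} (hW : HasGaussianLaw W P') (hmean : ∀ i, ∫ ω, W ω i ∂P' = 0)
    (hcov : ∀ i j, cov[fun ω => W ω i, fun ω => W ω j; P'] =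
      cov[fun ω => ξ 0 ω i, fun ω => ξ 0 ω j; P])
    (hξ : ∀ i, MemLp (fun ω => ξ 0 ω i) 2 P) (hindep : iIndepFun ξ P)
    (hident : ∀ k, IdentDistrib (ξ k) (ξ 0) P P) :
    TendstoInDistribution
      (fun (n : ℕ) ω i =>
        (√(n : ℝ))⁻¹ * (∑ k ∈ Finset.range n, ξ k ω i - n * ∫ ω, ξ 0 ω i ∂P))
      atTop W (fun _ => P) P' := by
  cases nonempty_fintype ι
  have hmeas (k : ℕ) (i : ι) : AEMeasurable (fun ω => ξ k ω i) P :=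
    (measurable_pi_apply i).comp_aemeasurable (hident k).aemeasurable_fst
  refine tendstoInDistribution_pi_of_forall_sum_mul (fun n => by fun_prop) hW.aemeasurable
    fun t => ?_
  have hdot : Measurable fun x : ι → ℝ => ∑ i, t i * x i := by fun_prop
  have hvar : Var[fun ω => ∑ i, t i * W ω i; P'] = Var[fun ω => ∑ i, t i * ξ 0 ω i; P] := by
    simp_rw [variance_sum_mul (fun i => (hW.eval i).memLp_two), variance_sum_mul hξ, hcov]
  have hlaw := hasLaw_sum_mul_of_hasGaussianLaw hW hmean t
  rw [hvar] at hlaw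
  have hclt := tendstoInDistribution_inv_sqrt_mul_sum_sub (X := fun k ω => ∑ i, t i * ξ k ω i) hlaw
    (memLp_finsetSum _ fun i _ => (hξ i).const_mul (t i)) (hindep.comp _ fun _ => hdot)
    fun k => (hident k).comp hdot
  convert hclt using 3 with n ω
  rw [integral_sum_mul (fun i => (hξ i).integrable one_le_two), Finset.sum_comm, Finset.mul_sum,
    ← Finset.sum_sub_distrib, Finset.mul_sum]
  refine Finset.sum_congr rfl fun i _ => ?_
  rw [← Finset.mul_sum]
  ring

end CentralLimit

section PointIndicator

variable {Ω α : Type*} [MeasurableSpace Ω] {P : Measure Ω} [MeasurableSpace α]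
  [MeasurableSingletonClass α] [DecidableEq α]

theorem measurable_ite_eq_one_zero (x : α) : Measurable fun y => if y = x then (1 : ℝ) else 0 :=
  Measurable.ite (measurableSet_singleton x) measurable_const measurable_const

theorem memLp_ite_eq_one_zero [IsFiniteMeasure P] {V : Ω → α} (hV : AEMeasurable V P) (x : α)
    (q : ENNReal) : MemLp (fun ω => if V ω = x then (1 : ℝ) else 0) q P := by
  refine MemLp.of_bound
    ((measurable_ite_eq_one_zero x).comp_aemeasurable hV).aestronglyMeasurable 1
    (ae_of_all _ fun ω => ?_)
  split_ifs <;> simp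

variable {p : PMF α} {V : Ω → α}

theorem integral_ite_eq_one_zero (hV : HasLaw V p.toMeasure P) (x : α) :
    ∫ ω, (if V ω = x then (1 : ℝ) else 0) ∂P = (p x).toReal := by
  refine (hV.integral_comp (measurable_ite_eq_one_zero x).aestronglyMeasurable).trans ?_
  have hindicator : (fun y => if y = x then (1 : ℝ) else 0) = Set.indicator {x} 1 := by
    ext y
    simp only [Set.indicator_apply, Set.mem_singleton_iff, Pi.one_apply]
  rw [hindicator, integral_indicator_one (measurableSet_singleton x), Measure.real,
    p.toMeasure_apply_singleton x (measurableSet_singleton x)]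

theorem covariance_ite_eq_one_zero (hV : HasLaw V p.toMeasure P) (x z : α) :
    cov[fun ω => if V ω = x then (1 : ℝ) else 0, fun ω => if V ω = z then (1 : ℝ) else 0; P] =
      (if x = z then (p x).toReal else 0) - (p x).toReal * (p z).toReal := by
  have := hV.isProbabilityMeasure
  rw [covariance_eq_sub (memLp_ite_eq_one_zero hV.aemeasurable x 2)
    (memLp_ite_eq_one_zero hV.aemeasurable z 2), integral_ite_eq_one_zero hV,
    integral_ite_eq_one_zero hV]
  congr 1
  have hprod (ω : Ω) : (if V ω = x then (1 : ℝ) else 0) * (if V ω = z then (1 : ℝ) else 0) =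
      if x = z then (if V ω = x then (1 : ℝ) else 0) else 0 := by
    grind
  simp only [Pi.mul_apply, hprod]
  split_ifs with hxz
  · exact integral_ite_eq_one_zero hV x
  · exact integral_zero Ω ℝ

end PointIndicator

theorem hasGaussianLaw_pi_of_isGaussianProcess {Ω ι : Type*} [MeasurableSpace Ω] {P : Measure Ω}
    [Finite ι] {Z : ι → Ω → ℝ} (hZ : IsGaussianProcess Z P) :
    HasGaussianLaw (fun ω i => Z i ω) P := by
  cases nonempty_fintype ι
  exact (hZ.hasGaussianLaw Finset.univ).map_fun (ContinuousLinearMap.pi fun i =>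
    ContinuousLinearMap.proj (R := ℝ) (φ := fun _ : (Finset.univ : Finset ι) => ℝ)
      ⟨i, Finset.mem_univ i⟩)

section EmpiricalMass

variable {Ω : Type*} {X : ℕ → Ω → ℕ}

theorem sum_empiricalMass_le_one (X : ℕ → Ω → ℕ) (n : ℕ) (ω : Ω) (F : Finset ℕ) :
    ∑ x ∈ F, empiricalMass X n ω x ≤ 1 := by
  have hcount : ∑ x ∈ F, ∑ i ∈ Finset.range n, (if X i ω = x then (1 : ℝ) else 0) ≤ n := by
    rw [Finset.sum_comm]
    refine (Finset.sum_le_card_nsmul _ _ 1 fun i _ => ?_).trans (by simp)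
    rw [Finset.sum_ite_eq]
    split_ifs <;> simp
  calc ∑ x ∈ F, empiricalMass X n ω x
      = (n : ℝ)⁻¹ * ∑ x ∈ F, ∑ i ∈ Finset.range n, (if X i ω = x then (1 : ℝ) else 0) :=
        (Finset.mul_sum ..).symm
    _ ≤ (n : ℝ)⁻¹ * n := by gcongr
    _ ≤ 1 := inv_mul_le_one

theorem le_sampleMax_of_empiricalMass_pos {n : ℕ} {ω : Ω} {x : ℕ}
    (hx : 0 < empiricalMass X n ω x) : x ≤ sampleMax X n ω := by
  obtain ⟨i, hi, hne⟩ := Finset.exists_ne_zero_of_sum_ne_zero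
    (pos_of_mul_pos_right hx (by positivity)).ne'
  obtain rfl : X i ω = x := of_not_not fun hix => hne (if_neg hix)
  exact Finset.le_sup (f := fun i => X i ω) hi

theorem fluctuation_empiricalMass (p : PMF ℕ) (X : ℕ → Ω → ℕ) (n : ℕ) (ω : Ω) (x : ℕ) :
    fluctuation p n (empiricalMass X n ω) x = (√(n : ℝ))⁻¹ *
      (∑ i ∈ Finset.range n, (if X i ω = x then (1 : ℝ) else 0) - n * (p x).toReal) := by
  unfold fluctuation empiricalMass
  have hinv : √(n : ℝ) * (n : ℝ)⁻¹ = (√(n : ℝ))⁻¹ := by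
    rw [← div_eq_mul_inv, Real.sqrt_div_self]
  have hmul : (√(n : ℝ))⁻¹ * n = √n := by
    rw [inv_mul_eq_div, Real.div_sqrt]
  rw [mul_sub, mul_sub, ← mul_assoc, ← mul_assoc, hinv, hmul]

variable {Ω' : Type*} [MeasurableSpace Ω] [MeasurableSpace Ω'] {P : Measure Ω} {P' : Measure Ω'}
  {p : PMF ℕ} {Y : ℕ → Ω' → ℝ}

theorem tendstoInDistribution_fluctuation_empiricalMass [IsProbabilityMeasure P]
    [IsProbabilityMeasure P'] {ι : Type*} [Finite ι]
    (hlaw : ∀ i, HasLaw (X i) p.toMeasure P) (hindep : iIndepFun X P)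
    (hY : IsLimitProcess p Y P') (a : ι → ℕ) :
    TendstoInDistribution (fun (n : ℕ) ω i => fluctuation p n (empiricalMass X n ω) (a i)) atTop
      (fun ω i => Y (a i) ω) (fun _ => P) P' := by
  have hmeas : Measurable fun (y : ℕ) (i : ι) => if y = a i then (1 : ℝ) else 0 :=
    measurable_of_countable _
  simp_rw [fluctuation_empiricalMass, ← integral_ite_eq_one_zero (hlaw 0)]
  refine tendstoInDistribution_pi_inv_sqrt_mul_sum_sub
    (ξ := fun k ω i => if X k ω = a i then (1 : ℝ) else 0)
    (hasGaussianLaw_pi_of_isGaussianProcess (hY.isGaussianProcess.comp_right a))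
    (fun i => hY.mean_zero (a i)) (fun i j => ?_)
    (fun i => memLp_ite_eq_one_zero (hlaw 0).aemeasurable (a i) 2)
    (hindep.comp _ fun _ => hmeas) fun k => ((hlaw k).identDistrib (hlaw 0)).comp hmeas
  rw [covariance_ite_eq_one_zero (hlaw 0)]
  exact hY.covariance_eq (a i) (a j)

theorem ae_tendsto_empiricalMass (hlaw : ∀ i, HasLaw (X i) p.toMeasure P)
    (hindep : iIndepFun X P) :
    ∀ᵐ ω ∂P, ∀ x, Tendsto (fun n => empiricalMass X n ω x) atTop (𝓝 (p x).toReal) := by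
  have := (hlaw 0).isProbabilityMeasure
  refine ae_all_iff.2 fun x => ?_
  have hmeas := measurable_ite_eq_one_zero x
  have hslln := strong_law_ae_real (μ := P) (fun i ω => if X i ω = x then (1 : ℝ) else 0)
    (memLp_one_iff_integrable.1 (memLp_ite_eq_one_zero (hlaw 0).aemeasurable x 1))
    (fun i j hij => (hindep.indepFun hij).comp hmeas hmeas)
    fun i => ((hlaw i).identDistrib (hlaw 0)).comp hmeas
  filter_upwards [hslln] with ω hω
  rw [integral_ite_eq_one_zero (hlaw 0)] at hω
  exact hω.congr fun n => div_eq_inv_mul _ _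

end EmpiricalMass

section Measurability

theorem aemeasurable_of_factorsThrough {Ω α β : Type*} [MeasurableSpace Ω] {P : Measure Ω}
    [MeasurableSpace α] [Countable α] [MeasurableSingletonClass α] [MeasurableSpace β] [Nonempty β]
    {V : Ω → α} {Z : Ω → β} (hZ : Z.FactorsThrough V) (hV : AEMeasurable V P) :
    AEMeasurable Z P := by
  obtain ⟨e, rfl⟩ := (Function.factorsThrough_iff Z).1 hZ
  exact (measurable_of_countable e).comp_aemeasurable hV

variable {Ω : Type*} {X : ℕ → Ω → ℕ} {n : ℕ} {ω ω' : Ω}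

theorem empiricalMass_congr (h : ∀ i < n, X i ω = X i ω') :
    empiricalMass X n ω = empiricalMass X n ω' := by
  ext x
  refine congrArg ((n : ℝ)⁻¹ * ·) (Finset.sum_congr rfl fun i hi => ?_)
  rw [h i (Finset.mem_range.1 hi)]

theorem sampleMax_congr (h : ∀ i < n, X i ω = X i ω') : sampleMax X n ω = sampleMax X n ω' :=
  Finset.sup_congr rfl fun i hi => h i (Finset.mem_range.1 hi)

theorem aemeasurable_block_fluctuation {Ψ : ∀ m, (Fin m → ℝ) → Fin m → ℝ} {p : PMF ℕ} {r s : ℕ}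
    [MeasurableSpace Ω] {P : Measure Ω} (hX : ∀ i, AEMeasurable (X i) P) :
    AEMeasurable
      (fun ω => block r s (fluctuation p n (zeroExtend (Ψ _ (empiricalVector X n ω))))) P := by
  refine aemeasurable_of_factorsThrough (V := fun ω (i : Fin n) => X i ω) (fun ω ω' h => ?_)
    (aemeasurable_pi_lambda _ fun i => hX i)
  have hX_eq : ∀ i < n, X i ω = X i ω' := fun i hi => congrFun h ⟨i, hi⟩
  exact congrArg₂ (fun (m : ℕ) (q : ℕ → ℝ) =>
    block r s (fluctuation p n (zeroExtend (Ψ (m + 1) fun x => q x))))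
    (sampleMax_congr hX_eq) (empiricalMass_congr hX_eq)

end Measurability

namespace IsBlockwiseEquivariant

variable {Ω : Type*} {Ψ : ∀ m, (Fin m → ℝ) → Fin m → ℝ} {p : PMF ℕ} {X : ℕ → Ω → ℕ} {r s : ℕ}

theorem block_fluctuation_eq (hΨ : IsBlockwiseEquivariant Ψ) {n : ℕ} (hn : 0 < n) {ω : Ω}
    (hrs : r ≤ s) (hflat : ∀ x ∈ Set.Icc r s, p x = p r)
    (hsep : IsSeparatedBlock (empiricalMass X n ω) r s) (hs : s ≤ sampleMax X n ω) :
    block r s (fluctuation p n (zeroExtend (Ψ _ (empiricalVector X n ω)))) =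
      Ψ _ (block r s (fluctuation p n (empiricalMass X n ω))) := by
  have haffine (phat : ℕ → ℝ) : block r s (fluctuation p n phat) =
      fun i => √(n : ℝ) * block r s phat i + -(√(n : ℝ) * (p r).toReal) := by
    ext i
    rw [block, fluctuation, hflat (r + i) ⟨by omega, by omega⟩, block]
    ring
  have hlocal : block r s (zeroExtend (Ψ _ (empiricalVector X n ω))) =
      Ψ _ (block r s (empiricalMass X n ω)) :=
    hΨ.block_zeroExtend hsep hrs (Nat.lt_succ_of_le hs)
  ext i
  rw [haffine, haffine, hΨ.map_mul_add _ (by positivity), hlocal]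

theorem eventually_block_fluctuation_eq (hΨ : IsBlockwiseEquivariant Ψ) {ω : Ω} (hrs : r ≤ s)
    (hflat : ∀ x ∈ Set.Icc r s, p x = p r) (hleft : ∀ x < r, p r < p x)
    (hright : ∀ x > s, p x < p r)
    (hlim : ∀ x, Tendsto (fun n => empiricalMass X n ω x) atTop (𝓝 (p x).toReal)) :
    ∀ᶠ n in atTop, block r s (fluctuation p n (zeroExtend (Ψ _ (empiricalVector X n ω)))) =
      Ψ _ (block r s (fluctuation p n (empiricalMass X n ω))) := by
  have htotal : HasSum (fun x => (p x).toReal) 1 := by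
    have h := ENNReal.hasSum_toReal p.tsum_coe_ne_top
    rwa [← ENNReal.tsum_toReal_eq p.apply_ne_top, p.tsum_coe, ENNReal.toReal_one] at h
  have htoReal {x y : ℕ} (hxy : p x < p y) : (p x).toReal < (p y).toReal :=
    (ENNReal.toReal_lt_toReal (p.apply_ne_top x) (p.apply_ne_top y)).2 hxy
  have hpos : ∀ y ∈ Set.Icc r s, 0 < (p y).toReal := fun y hy =>
    ENNReal.toReal_nonneg.trans_lt (htoReal ((hright _ s.lt_succ_self).trans_eq (hflat y hy).symm))
  have hsep := eventually_isSeparatedBlock htotal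
    (fun n => sum_empiricalMass_le_one X n ω) hlim hpos
    (fun x hx y hy => htoReal ((hflat y hy).trans_lt (hleft x hx)))
    (fun y hy x hx => htoReal ((hright x hx).trans_eq (hflat y hy).symm))
  filter_upwards [hsep, (hlim s).eventually_const_lt (hpos s ⟨hrs, le_rfl⟩),
    eventually_gt_atTop 0] with n hsep hs hn
  exact hΨ.block_fluctuation_eq hn hrs hflat hsep (le_sampleMax_of_empiricalMass_pos hs)

variable [MeasurableSpace Ω] {Ω' : Type*} [MeasurableSpace Ω'] {P : Measure Ω} {P' : Measure Ω'}
  {Y : ℕ → Ω' → ℝ}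

theorem tendstoInDistribution_block_fluctuation [IsProbabilityMeasure P] [IsProbabilityMeasure P']
    (hΨ : IsBlockwiseEquivariant Ψ) (hlaw : ∀ i, HasLaw (X i) p.toMeasure P)
    (hindep : iIndepFun X P) (hY : IsLimitProcess p Y P') (hrs : r ≤ s)
    (hflat : ∀ x ∈ Set.Icc r s, p x = p r) (hleft : ∀ x < r, p r < p x)
    (hright : ∀ x > s, p x < p r) :
    TendstoInDistribution
      (fun (n : ℕ) ω => block r s (fluctuation p n (zeroExtend (Ψ _ (empiricalVector X n ω)))))
      atTop (fun ω => Ψ _ (block r s fun x => Y x ω)) (fun _ => P) P' := by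
  have hclt : TendstoInDistribution
      (fun (n : ℕ) ω => Ψ _ (block r s (fluctuation p n (empiricalMass X n ω)))) atTop
      (fun ω => Ψ _ (block r s fun x => Y x ω)) (fun _ => P) P' :=
    (tendstoInDistribution_fluctuation_empiricalMass hlaw hindep hY
      fun i : Fin (s - r + 1) => r + i).continuous_comp (hΨ.continuous _)
  have hmeas (n : ℕ) := aemeasurable_block_fluctuation (p := p) (Ψ := Ψ) (r := r) (s := s) (n := n)
    fun i => (hlaw i).aemeasurable
  refine tendstoInDistribution_of_tendstoInMeasure_sub _ _ hclt
    (tendstoInMeasure_of_tendsto_ae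
      (fun n => ((hmeas n).sub (hclt.forall_aemeasurable n)).aestronglyMeasurable) ?_) hmeas
  filter_upwards [ae_tendsto_empiricalMass hlaw hindep] with ω hω
  refine tendsto_const_nhds.congr' ?_
  filter_upwards [hΨ.eventually_block_fluctuation_eq hrs hflat hleft hright hω] with n hn
  simp only [Pi.sub_apply, Pi.zero_apply, hn, sub_self]

end IsBlockwiseEquivariant

theorem mainTheorem6_general
    {Ω Ω' : Type*} [MeasurableSpace Ω] [MeasurableSpace Ω']
    (P : Measure Ω) [IsProbabilityMeasure P] (P' : Measure Ω') [IsProbabilityMeasure P']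
    (p : PMF ℕ)
    (X : ℕ → Ω → ℕ) (hlaw : ∀ i, HasLaw (X i) p.toMeasure P) (hindep : iIndepFun X P)
    (Y : ℕ → Ω' → ℝ) (hY : IsLimitProcess p Y P')
    (r s : ℕ) (hrs : r ≤ s)
    (hflat : ∀ x ∈ Set.Icc r s, p x = p r)
    (hleft : ∀ x < r, p r < p x)
    (hright : ∀ x > s, p x < p r) :
    TendstoInDistribution
        (fun (n : ℕ) ω => block r s (fluctuation p n (rearrangementEstimator X n ω)))
        atTop (fun ω => rear (block r s fun x => Y x ω)) (fun _ => P) P' ∧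
      TendstoInDistribution
        (fun (n : ℕ) ω => block r s (fluctuation p n (grenanderEstimator X n ω)))
        atTop (fun ω => gren (block r s fun x => Y x ω)) (fun _ => P) P' :=
  ⟨isBlockwiseEquivariant_rear.tendstoInDistribution_block_fluctuation hlaw hindep hY hrs hflat
      hleft hright,
    isBlockwiseEquivariant_gren.tendstoInDistribution_block_fluctuation hlaw hindep hY hrs hflat
      hleft hright⟩

theorem mainTheorem6
    {Ω Ω' : Type*} [MeasurableSpace Ω] [MeasurableSpace Ω']
    (P : Measure Ω) [IsProbabilityMeasure P] (P' : Measure Ω') [IsProbabilityMeasure P']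
    (p : PMF ℕ) (hp : Antitone p)
    (X : ℕ → Ω → ℕ) (hlaw : ∀ i, HasLaw (X i) p.toMeasure P) (hindep : iIndepFun X P)
    (Y : ℕ → Ω' → ℝ) (hY : IsLimitProcess p Y P')
    (r s : ℕ) (hrs : r < s)
    (hflat : ∀ x ∈ Set.Icc r s, p x = p r)
    (hleft : ∀ x, x + 1 = r → p r < p x)
    (hright : p (s + 1) < p s) :
    TendstoInDistribution
        (fun (n : ℕ) ω => block r s (fluctuation p n (rearrangementEstimator X n ω)))
        atTop (fun ω => rear (block r s fun x => Y x ω)) (fun _ => P) P' ∧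
      TendstoInDistribution
        (fun (n : ℕ) ω => block r s (fluctuation p n (grenanderEstimator X n ω)))
        atTop (fun ω => gren (block r s fun x => Y x ω)) (fun _ => P) P' :=
  mainTheorem6_general P P' p X hlaw hindep Y hY r s hrs.le hflat
    (fun x hx => (hleft (r - 1) (by omega)).trans_le (hp (by omega)))
    fun x hx => (hp hx).trans_lt (hright.trans_eq (hflat s ⟨hrs.le, le_rfl⟩))
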